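/- We work over $\mathbb{C}$. Let $r\geq 2$, and let $n=(n_1,\dots,n_r)$ and $d=(d_1,\dots,d_{r-1},1)$ be $r$-tuples of positive integers with $n_r>n_1+\dots+n_{r-1}$. Let $SV^n_d\subset\mathbb{P}^N$, with $N=\prod_{i=1}^r\binom{n_i+d_i}{n_i}-1$, be the Segre-Veronese variety, that is, the product $\mathbb{P}^{n_1}\times\dots\times\mathbb{P}^{n_r}$ embedded by the complete linear system $|\mathcal{O}(d_1,\dots,d_r)|$ (where $d_r=1$). For a projective variety $X\subset\mathbb{P}^N$, points $x_1,\dots,x_h\in X$ and a linear subspace $\Pi\subset\mathbb{P}^N$ of dimension $s$ containing the span $\langle T_{x_1}X,\dots,T_{x_h}X\rangle$ of the embedded tangent spaces, the tangential contact locus $\Gamma_{x_1,\dots,x_h,\Pi}$ is the closure in $X$ of the union of those irreducible components of $\{x\in X : T_xX\subseteq\Pi\}$ that contain at least one of the $x_i$. The variety $X$ is called $(h,s)$-tangentially weakly defective if $\dim\Gamma_{x_1,\dots,x_h,\Pi}>0$ for $x_1,\dots,x_h\in X$ general and $\Pi$ general among the $s$-dimensional linear subspaces containing $\langle T_{x_1}X,\dots,T_{x_h}X\rangle$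 (in particular, such subspaces exist). If $s$ is a non-negative integer with $$s\leq \prod_{i=2}^r\binom{n_i+d_i}{n_i}-n_r\sum_{i=1}^{r-1}n_i,$$ then $SV^n_d$ is not $(1,s)$-tangentially weakly defective. -/

import Mathlib

open scoped LinearAlgebra.Projectivization Topology

noncomputable section

namespace SegreVeronese

/-- The complex projective space whose homogeneous coordinates are indexed by `σ`. -/
def PSpace (σ : Type*) : Type _ := ℙ ℂ (σ → ℂ)

/-- Homogeneous coordinates of a point (defined up to a nonzero scalar). -/
def PSpace.coords {σ : Type*} (p : PSpace σ) : σ → ℂ :=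
  Projectivization.rep (K := ℂ) (V := σ → ℂ) p

/-- The Zariski topology of projective space: a basis of open sets is given by the
non-vanishing loci of homogeneous polynomials. -/
instance {σ : Type*} : TopologicalSpace (PSpace σ) :=
  TopologicalSpace.generateFrom
    {U | ∃ (f : MvPolynomial σ ℂ) (m : ℕ), f.IsHomogeneous m ∧
      U = {p | MvPolynomial.eval p.coords f ≠ 0}}

/-- A polynomial in `h` groups of variables is multihomogeneous if it is homogeneous of some
degree `m i` in the `i`-th group of variables, for every `i`. -/
def IsMultihomogeneous {σ : Type*} {h : ℕ} (f : MvPolynomial (Fin h × σ) ℂ) : Prop :=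
  ∃ m : Fin h → ℕ, ∀ i : Fin h,
    MvPolynomial.IsWeightedHomogeneous
      (fun v : Fin h × σ => if v.1 = i then (1 : ℕ) else 0) f (m i)

/-- The Zariski topology of the product of `h` copies of a projective space (finer than the
product topology): a basis of open sets is given by the non-vanishing loci of multihomogeneous
polynomials. -/
@[reducible] def multiZariski (h : ℕ) (σ : Type*) : TopologicalSpace (Fin h → PSpace σ) :=
  TopologicalSpace.generateFrom
    {U | ∃ f : MvPolynomial (Fin h × σ) ℂ, IsMultihomogeneous f ∧
      U = {x | MvPolynomial.eval (fun v : Fin h × σ => (x v.1).coords v.2) f ≠ 0}}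

/-- The Zariski topology of affine space. -/
@[reducible] def affineZariski (ι : Type*) : TopologicalSpace (ι → ℂ) :=
  TopologicalSpace.generateFrom
    {U | ∃ f : MvPolynomial ι ℂ, U = {x | MvPolynomial.eval x f ≠ 0}}

/-- The Grassmannian of `k`-dimensional linear subspaces of `ℂ^σ`, that is, of linear subspaces
of dimension `k - 1` of the projective space. -/
def Gr (k : ℕ) (σ : Type*) : Type _ :=
  {W : Submodule ℂ (σ → ℂ) // Module.finrank ℂ W = k}

/-- The linear subspace underlying a point of the Grassmannian. -/
def Gr.toSubmodule {k : ℕ} {σ : Type*} (W : Gr k σ) : Submodule ℂ (σ → ℂ) := W.1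

/-- The `k`-frames in `ℂ^σ`. -/
def Frame (k : ℕ) (σ : Type*) : Type _ :=
  {w : Fin k → σ → ℂ // LinearIndependent ℂ w}

/-- The linear subspace spanned by a frame. -/
def Frame.span {k : ℕ} {σ : Type*} (w : Frame k σ) : Gr k σ :=
  ⟨Submodule.span ℂ (Set.range w.1), by simpa using finrank_span_eq_card w.2⟩

/-- The Zariski topology of the Grassmannian: it is the quotient of the space of `k`-frames, a
Zariski open subset of the affine space of `k × σ` matrices, by the action of `GL_k`. -/
instance {k : ℕ} {σ : Type*} : TopologicalSpace (Gr k σ) :=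
  TopologicalSpace.coinduced Frame.span
    (TopologicalSpace.induced (fun (w : Frame k σ) (v : Fin k × σ) => w.1 v.1 v.2)
      (affineZariski (Fin k × σ)))

/-- The embedded projective tangent space `T_p X` of `X` at `p`, as a linear subspace of `ℂ^σ`:
it is cut out by the differentials at `p` of the homogeneous polynomials vanishing on `X`. -/
def tangentSpace {σ : Type*} [Fintype σ] (X : Set (PSpace σ)) (p : PSpace σ) :
    Submodule ℂ (σ → ℂ) where
  carrier := {v | ∀ (f : MvPolynomial σ ℂ) (m : ℕ), f.IsHomogeneous m →
    (∀ q ∈ X, MvPolynomial.eval q.coords f = 0) →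
    ∑ j, MvPolynomial.eval p.coords (MvPolynomial.pderiv j f) * v j = 0}
  zero_mem' := by intro f m _ _; simp
  add_mem' := by
    intro a b ha hb f m hf hX
    simp [mul_add, Finset.sum_add_distrib, ha f m hf hX, hb f m hf hX]
  smul_mem' := by
    intro c a ha f m hf hX
    have := ha f m hf hX
    simp only [Pi.smul_apply, smul_eq_mul, mul_left_comm _ c, ← Finset.mul_sum, this, mul_zero]

/-- The locus of the points of `X` at which the linear space `L` is tangent to `X`. -/
def tangencyLocus {σ : Type*} [Fintype σ] (X : Set (PSpace σ)) (L : Submodule ℂ (σ → ℂ)) :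
    Set (PSpace σ) :=
  {q | q ∈ X ∧ tangentSpace X q ≤ L}

/-- The irreducible components of a subset of projective space. -/
def components {σ : Type*} (C : Set (PSpace σ)) : Set (Set (PSpace σ)) :=
  {Z | Maximal (fun S : Set (PSpace σ) => IsIrreducible S ∧ S ⊆ C) Z}

/-- The tangential contact locus of a closed subset `X` with respect to the points `x i` and the
linear space `L`: the closure of the union of the irreducible components, containing at least
one of the `x i`, of the locus where `L` is tangent to `X`. -/
def contactLocus {σ : Type*} [Fintype σ] (X : Set (PSpace σ)) {h : ℕ} (x : Fin h → PSpace σ)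
    (L : Submodule ℂ (σ → ℂ)) : Set (PSpace σ) :=
  closure (⋃₀ {Z | Z ∈ components (tangencyLocus X L) ∧ ∃ i, x i ∈ Z})

/-- The linear span of the tangent spaces of `X` at the points `x i`. -/
def tangentSpan {σ : Type*} [Fintype σ] (X : Set (PSpace σ)) {h : ℕ} (x : Fin h → PSpace σ) :
    Submodule ℂ (σ → ℂ) :=
  ⨆ i, tangentSpace X (x i)

/-- A projective variety `X` (an irreducible closed subset of projective space) is
`(h,s)`-tangentially weakly defective if for general points `x_1, …, x_h` of `X` and a general
linear subspace `L` of projective dimension `s` containing the span of the tangent spaces of `X`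
at the `x_i`, the tangential contact locus has positive dimension. "General" means: in some
nonempty Zariski open subset of `X^h`, respectively of the variety of all such `L`; in particular
there has to be some such `L`. -/
def IsTangentiallyWeaklyDefective {σ : Type*} [Fintype σ] (h s : ℕ) (X : Set (PSpace σ)) : Prop :=
  ∃ U : Set (Fin h → PSpace σ), IsOpen[multiZariski h σ] U ∧ (∃ x ∈ U, ∀ i, x i ∈ X) ∧
    ∀ x ∈ U, (∀ i, x i ∈ X) →
      ∃ G : Set (Gr (s + 1) σ), IsOpen G ∧ (∃ L ∈ G, tangentSpan X x ≤ L.toSubmodule) ∧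
        ∀ L ∈ G, tangentSpan X x ≤ L.toSubmodule →
          0 < topologicalKrullDim (contactLocus X x L.toSubmodule)

/-- The index set of the monomials of multidegree `d = (d_1, …, d_r)` in `r` groups of
`n_1 + 1, …, n_r + 1` variables. -/
abbrev MonomialIndex {r : ℕ} (n d : Fin r → ℕ) : Type :=
  ∀ i : Fin r, Sym (Fin (n i + 1)) (d i)

/-- The vector of the values of all the monomials of multidegree `d`. -/
def monomialVector {r : ℕ} (n d : Fin r → ℕ) (x : ∀ i : Fin r, Fin (n i + 1) → ℂ) :
    MonomialIndex n d → ℂ :=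
  fun J => ∏ i, ((J i : Multiset (Fin (n i + 1))).map (x i)).prod

theorem monomialVector_ne_zero {r : ℕ} (n d : Fin r → ℕ) (x : ∀ i : Fin r, Fin (n i + 1) → ℂ)
    (hx : ∀ i, x i ≠ 0) : monomialVector n d x ≠ 0 := by
  choose j hj using fun i => Function.ne_iff.mp (hx i)
  intro h
  have h1 := congrFun h (fun i => Sym.replicate (d i) (j i))
  simp only [monomialVector, Sym.coe_replicate, Multiset.map_replicate, Multiset.prod_replicate,
    Pi.zero_apply, Finset.prod_eq_zero_iff, Finset.mem_univ, true_and] at h1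
  obtain ⟨i, hi⟩ := h1
  exact pow_ne_zero _ (hj i) hi

/-- The Segre-Veronese variety `SV^n_d`: the image of `ℙ^{n_1} × ⋯ × ℙ^{n_r}` under the map given
by all the monomials of multidegree `(d_1, …, d_r)`, i.e. by the complete linear system
`|O(d_1, …, d_r)|`. -/
def segreVeronese {r : ℕ} (n d : Fin r → ℕ) : Set (PSpace (MonomialIndex n d)) :=
  {p | ∃ (x : ∀ i : Fin r, Fin (n i + 1) → ℂ) (hx : ∀ i, x i ≠ 0),
    p = Projectivization.mk ℂ (monomialVector n d x) (monomialVector_ne_zero n d x hx)}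

end SegreVeronese

end

/-! At any point `x` of the variety, a tangent space `L` in the given open set `G` can be moved
within `G` so that its contact at `x` becomes isolated.

Let `B` index the local coordinates at `x`, centred there, and let `Φ` be the chart. The bound on
`s` makes the codimension of `L` at least `card B`, so `L` is killed by independent functionals `φ
b`, one for each coordinate. If `L` contains the tangent space at `Φ u`, all first derivatives at
`u` of the pullbacks of the `φ b` vanish. Keeping one derivative, in the direction `β b`, for each
`b` gives a square polynomial system; an invertible Jacobian `J` at the origin isolates `x`
(`exists_isolating_polynomial`), and every component of the tangency locus through `x` is then a
point.

If `J` is singular, replace `φ b` by `φ b + t • Q b`, where `Q b` restricts to `u_b * u_(β b)`. Such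
a linear functional exists when `β b` lies in another factor than `b`, whatever the degrees, and
this is where two factors are needed. It kills the tangent space at `x`, while differentiating along
`β b` leaves `u_b`, so the Jacobian becomes `J + t`, invertible for small nonzero `t`. The new
functionals kill a small deformation of `L`, which still lies in `G` (`eventually_exists_eq_comap`).
-/

noncomputable section

namespace SegreVeronese

open MvPolynomial

/-! ### Zariski topology of projective space and linear forms -/

section Projective

variable {σ : Type*}

theorem PSpace.exists_coords_mk (v : σ → ℂ) (hv : v ≠ 0) :
    ∃ c : ℂ, c ≠ 0 ∧ PSpace.coords (Projectivization.mk ℂ v hv : PSpace σ) = c • v := by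
  obtain ⟨a, ha⟩ := Projectivization.exists_smul_eq_mk_rep ℂ v hv
  exact ⟨a, a.ne_zero, ha.symm⟩

theorem PSpace.eq_of_coords_eq_smul {p q : PSpace σ} {c : ℂ} (h : q.coords = c • p.coords) :
    q = p := by
  have hp : p = Projectivization.mk ℂ p.coords (Projectivization.rep_nonzero p) :=
    (Projectivization.mk_rep p).symm
  have hq : q = Projectivization.mk ℂ q.coords (Projectivization.rep_nonzero q) :=
    (Projectivization.mk_rep q).symm
  rw [hp, hq]
  exact (Projectivization.mk_eq_mk_iff' ℂ _ _ _ _).2 ⟨c, h.symm⟩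

theorem eval_smul_of_isHomogeneous {f : MvPolynomial σ ℂ} {m : ℕ} (hf : f.IsHomogeneous m)
    (c : ℂ) (v : σ → ℂ) : eval (c • v) f = c ^ m * eval v f := by
  rw [eval_eq, eval_eq, Finset.mul_sum]
  refine Finset.sum_congr rfl fun e he => ?_
  have hdeg : ∑ i ∈ e.support, e i = m := by
    have := hf (mem_support_iff.1 he)
    rw [Finsupp.weight_apply, Finsupp.sum] at this
    simpa using this
  simp only [Pi.smul_apply, smul_eq_mul, mul_pow, Finset.prod_mul_distrib]
  rw [Finset.prod_pow_eq_pow_sum, hdeg]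
  ring

theorem isOpen_ne (x : PSpace σ) : IsOpen {p : PSpace σ | p ≠ x} := by
  have hx : x.coords ≠ 0 := Projectivization.rep_nonzero x
  obtain ⟨i, hi⟩ := Function.ne_iff.mp hx
  -- Because `x.coords i` is nonzero, the 2×2 minors that involve the column `i` already cut out
  -- `x`.
  have key : {p : PSpace σ | p ≠ x} = ⋃ j : σ, {p : PSpace σ |
      eval p.coords (C (x.coords i) * X j - C (x.coords j) * X i : MvPolynomial σ ℂ) ≠ 0} := by
    ext p
    simp only [Set.mem_ofPred_eq, Set.mem_iUnion, map_sub, map_mul, eval_C, eval_X]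
    constructor
    · intro hp
      by_contra! hcon
      refine hp (PSpace.eq_of_coords_eq_smul (c := p.coords i / x.coords i) ?_)
      ext j
      have hi' : x.coords i ≠ 0 := hi
      have := hcon j
      simp only [Pi.smul_apply, smul_eq_mul]
      field_simp
      linear_combination this
    · rintro ⟨j, hj⟩ rfl
      exact hj (by ring)
  rw [key]
  refine isOpen_iUnion fun j => TopologicalSpace.isOpen_generateFrom_of_mem ⟨_, 1, ?_, rfl⟩
  refine IsHomogeneous.sub ?_ ?_
  · simpa using (isHomogeneous_C σ _).mul (isHomogeneous_X ℂ j)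
  · simpa using (isHomogeneous_C σ _).mul (isHomogeneous_X ℂ i)

theorem isClosed_singleton (x : PSpace σ) : IsClosed ({x} : Set (PSpace σ)) :=
  ⟨isOpen_ne x⟩

variable [Fintype σ]

/-- If `x` is isolated in the tangency locus, then the contact locus is contained in `{x}`. -/
theorem contactLocus_subset_singleton {X : Set (PSpace σ)} (x : Fin 1 → PSpace σ)
    {L : Submodule ℂ (σ → ℂ)} {V : Set (PSpace σ)} (hV : IsOpen V) (hx : x 0 ∈ V)
    (h : ∀ q ∈ V, q ∈ tangencyLocus X L → q = x 0) : contactLocus X x L ⊆ {x 0} := by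
  refine closure_minimal (Set.sUnion_subset ?_) (isClosed_singleton _)
  rintro Z ⟨⟨⟨hZ, hZL⟩, -⟩, i, hi⟩
  rw [Subsingleton.elim i 0] at hi
  -- A nonempty open part of an irreducible set is dense in it, and here that part is the closed
  -- point `x 0`.
  refine (subset_closure_inter_of_isPreirreducible_of_isOpen hZ.2 hV ⟨x 0, hi, hx⟩).trans ?_
  exact closure_minimal (fun q hq => h q hq.2 (hZL hq.1)) (isClosed_singleton _)

theorem topologicalKrullDim_nonpos_of_subset_singleton {T : Type*} [TopologicalSpace T] {S : Set T}
    {x : T} (h : S ⊆ {x}) : topologicalKrullDim S ≤ 0 := by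
  have : Subsingleton S := (Set.subsingleton_singleton.anti h).coe_sort
  have : Subsingleton (TopologicalSpace.IrreducibleCloseds S) := by
    refine ⟨fun a b => TopologicalSpace.IrreducibleCloseds.ext ?_⟩
    rw [Subsingleton.eq_univ_of_nonempty a.isIrreducible.nonempty,
      Subsingleton.eq_univ_of_nonempty b.isIrreducible.nonempty]
  exact Order.krullDim_nonpos_of_subsingleton

theorem dual_apply_eq_sum [DecidableEq σ] (F : Module.Dual ℂ (σ → ℂ)) (v : σ → ℂ) :
    F v = ∑ j, F (Pi.single j 1) * v j := by
  rw [LinearMap.pi_apply_eq_sum_univ F v]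
  refine Finset.sum_congr rfl fun j _ => ?_
  rw [smul_eq_mul, mul_comm]
  congr 2
  ext i
  simp [Pi.single_apply, eq_comm]

/-- The linear form associated with a linear functional. -/
def linearForm (F : Module.Dual ℂ (σ → ℂ)) : MvPolynomial σ ℂ := by
  classical exact ∑ j, C (F (Pi.single j 1)) * X j

theorem eval_linearForm (F : Module.Dual ℂ (σ → ℂ)) (v : σ → ℂ) :
    eval v (linearForm F) = F v := by
  classical
  simp [linearForm, dual_apply_eq_sum F v]

theorem isHomogeneous_linearForm (F : Module.Dual ℂ (σ → ℂ)) :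
    (linearForm F).IsHomogeneous 1 := by
  classical
  refine IsHomogeneous.sum _ _ _ fun j _ => ?_
  simpa using (isHomogeneous_C σ _).mul (isHomogeneous_X ℂ j)

theorem sum_pderiv_linearForm (F : Module.Dual ℂ (σ → ℂ)) (p v : σ → ℂ) :
    ∑ j, eval p (pderiv j (linearForm F)) * v j = F v := by
  classical
  rw [dual_apply_eq_sum F v]
  refine Finset.sum_congr rfl fun j _ => ?_
  simp only [linearForm, map_sum, Derivation.leibniz, pderiv_C, pderiv_X, smul_eq_mul, map_mul,
    eval_C, mul_zero, add_zero]
  rw [Finset.sum_eq_single j (by intro b _ hb; simp [hb]) (by simp)]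
  simp

/-- A power of `F` clears the denominators of a polynomial in the ratios `U b / F`. The exponent `D`
need not be minimal: sums are brought to a common degree by cross-multiplying with powers of `F`. -/
theorem exists_homogenization {B : Type*} (F : Module.Dual ℂ (σ → ℂ))
    (U : B → Module.Dual ℂ (σ → ℂ)) (h : MvPolynomial B ℂ) :
    ∃ (D : ℕ) (H : MvPolynomial σ ℂ), H.IsHomogeneous D ∧
      ∀ v, F v ≠ 0 → eval v H = F v ^ D * eval (fun b => U b v / F v) h := by
  induction h using MvPolynomial.induction_on with
  | C a => exact ⟨0, C a, isHomogeneous_C _ _, fun v _ => by simp⟩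
  | add p q hp hq =>
    obtain ⟨D, H, hH, h1⟩ := hp
    obtain ⟨E, K, hK, h2⟩ := hq
    refine ⟨D + E, H * linearForm F ^ E + linearForm F ^ D * K, ?_, fun v hv => ?_⟩
    · refine (hH.mul ?_).add (IsHomogeneous.mul ?_ hK)
      · simpa using (isHomogeneous_linearForm F).pow E
      · simpa using (isHomogeneous_linearForm F).pow D
    · simp only [map_add, map_mul, map_pow, eval_linearForm, h1 v hv, h2 v hv]
      ring
  | mul_X p b hp =>
    obtain ⟨D, H, hH, h1⟩ := hp
    refine ⟨D + 1, H * linearForm (U b), hH.mul (isHomogeneous_linearForm _), fun v hv => ?_⟩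
    simp only [map_mul, eval_linearForm, h1 v hv, eval_X, pow_succ]
    field_simp

theorem isOpen_affineChart_ne_zero {B : Type*} (F : Module.Dual ℂ (σ → ℂ))
    (U : B → Module.Dual ℂ (σ → ℂ)) (h : MvPolynomial B ℂ) :
    IsOpen {p : PSpace σ | F p.coords ≠ 0 ∧
      eval (fun b => U b p.coords / F p.coords) h ≠ 0} := by
  obtain ⟨D, H, hH, h1⟩ := exists_homogenization F U h
  refine TopologicalSpace.isOpen_generateFrom_of_mem
    ⟨linearForm F * H, 1 + D, (isHomogeneous_linearForm F).mul hH, ?_⟩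
  ext p
  simp only [Set.mem_ofPred_eq, map_mul, eval_linearForm]
  by_cases hF : F p.coords = 0
  · simp [hF]
  · simp [hF, h1 _ hF]

/-- If the quadric `F * G = U * W` contains `X` and `F`, `U`, `W` vanish at `p` but `G` does not,
then `F` vanishes on the tangent space at `p`. -/
theorem eq_zero_of_mem_tangentSpace {X : Set (PSpace σ)} {p : PSpace σ}
    {F G U W : Module.Dual ℂ (σ → ℂ)}
    (h : ∀ q ∈ X, F q.coords * G q.coords = U q.coords * W q.coords)
    (hF : F p.coords = 0) (hU : U p.coords = 0) (hW : W p.coords = 0) (hG : G p.coords ≠ 0)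
    {v : σ → ℂ} (hv : v ∈ tangentSpace X p) : F v = 0 := by
  -- By the Leibniz rule, the differential of the quadric at `p` reduces to `G p • F`, the other
  -- three terms having a vanishing factor.
  have := hv (linearForm F * linearForm G - linearForm U * linearForm W) 2
    (((isHomogeneous_linearForm F).mul (isHomogeneous_linearForm G)).sub
      ((isHomogeneous_linearForm U).mul (isHomogeneous_linearForm W)))
    (fun q hq => by simp [eval_linearForm, h q hq])
  simp only [map_sub, Derivation.leibniz, smul_eq_mul, map_add, map_mul, eval_linearForm, hF, hU,
    hW, zero_mul, zero_add, add_zero, sub_zero, mul_assoc, ← Finset.mul_sum,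
    sum_pderiv_linearForm] at this
  exact (mul_eq_zero.1 this).resolve_left hG

end Projective

/-! ### Parametrizations and isolated zeros of polynomial systems -/

section Polynomials

variable {σ B : Type*}

theorem eval_bind₁_eq (Φ : σ → MvPolynomial B ℂ) (u : B → ℂ) (f : MvPolynomial σ ℂ) :
    eval u (bind₁ Φ f) = eval (fun j => eval u (Φ j)) f :=
  eval₂Hom_bind₁ (RingHom.id ℂ) u Φ f

variable [Fintype σ]

theorem pderiv_bind₁ (Φ : σ → MvPolynomial B ℂ) (b : B) (f : MvPolynomial σ ℂ) :
    pderiv b (bind₁ Φ f) = ∑ j, bind₁ Φ (pderiv j f) * pderiv b (Φ j) := by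
  classical
  induction f using MvPolynomial.induction_on with
  | C a => simp
  | add p q hp hq => simp [hp, hq, add_mul, Finset.sum_add_distrib]
  | mul_X p i hp =>
    simp only [map_mul, bind₁_X_right, Derivation.leibniz, smul_eq_mul, map_add, hp, pderiv_X,
      add_mul, Finset.sum_add_distrib, Finset.mul_sum]
    congr 1
    · rw [Finset.sum_eq_single i (by intro c _ hc; simp [hc.symm]) (by simp)]
      simp
    · exact Finset.sum_congr rfl fun j _ => by ring

/-- The partial derivatives of a parametrization are tangent vectors. -/
theorem pderiv_mem_tangentSpace {X : Set (PSpace σ)} (Φ : σ → MvPolynomial B ℂ)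
    (hΦ : ∀ u, (fun j => eval u (Φ j)) ≠ 0)
    (hX : ∀ u, (Projectivization.mk ℂ _ (hΦ u) : PSpace σ) ∈ X) (u : B → ℂ) (b : B) :
    (fun j => eval u (pderiv b (Φ j))) ∈
      tangentSpace X (Projectivization.mk ℂ _ (hΦ u) : PSpace σ) := by
  intro f m hf hfX
  -- An equation of `X` pulls back to a polynomial vanishing at every point, hence to zero; the
  -- chain rule then gives tangency. The scalar `c` relating the chosen representative to `Φ u` is
  -- absorbed by homogeneity.
  have hzero : bind₁ Φ f = 0 := by
    refine MvPolynomial.funext fun w => ?_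
    obtain ⟨c, hc, hcw⟩ := PSpace.exists_coords_mk _ (hΦ w)
    have := hfX _ (hX w)
    rw [hcw, eval_smul_of_isHomogeneous hf] at this
    rw [map_zero, eval_bind₁_eq]
    exact (mul_eq_zero.1 this).resolve_left (pow_ne_zero _ hc)
  obtain ⟨c, hc, hcu⟩ := PSpace.exists_coords_mk _ (hΦ u)
  have h := congrArg (eval u) (pderiv_bind₁ Φ b f)
  rw [hzero] at h
  simp only [map_zero, map_sum, map_mul, eval_bind₁_eq] at h
  simp only [hcu, eval_smul_of_isHomogeneous (hf.pderiv), mul_assoc, ← Finset.mul_sum, ← h,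
    mul_zero]

/-- Hadamard's lemma; the `A b` are not unique, but their values at the origin are the partial
derivatives of `g` there. -/
theorem exists_eq_add_sum_X_mul [Fintype B] (g : MvPolynomial B ℂ) :
    ∃ A : B → MvPolynomial B ℂ, g = C (eval 0 g) + ∑ b, X b * A b := by
  classical
  induction g using MvPolynomial.induction_on with
  | C a => exact ⟨0, by simp⟩
  | add p q hp hq =>
    obtain ⟨A, hA⟩ := hp
    obtain ⟨A', hA'⟩ := hq
    refine ⟨A + A', ?_⟩
    simp only [Pi.add_apply, mul_add, Finset.sum_add_distrib, map_add]
    linear_combination hA + hA'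
  | mul_X p i hp =>
    refine ⟨Pi.single i p, ?_⟩
    rw [Finset.sum_eq_single i (by intro c _ hc; simp [hc]) (by simp)]
    simp [mul_comm]

/-- A polynomial square system whose Jacobian matrix at the origin is invertible has the origin as
an isolated zero in the Zariski topology. -/
theorem exists_isolating_polynomial [Fintype B] [DecidableEq B] (g : B → MvPolynomial B ℂ)
    (h0 : ∀ b, eval 0 (g b) = 0)
    (hJ : (Matrix.of fun b c => eval 0 (pderiv c (g b))).det ≠ 0) :
    ∃ h : MvPolynomial B ℂ, eval 0 h ≠ 0 ∧
      ∀ u, eval u h ≠ 0 → (∀ b, eval u (g b) = 0) → u = 0 := by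
  choose A hA using fun b => exists_eq_add_sum_X_mul (g b)
  have hAJ : ∀ b c, eval 0 (pderiv c (g b)) = eval 0 (A b c) := by
    intro b c
    rw [hA b]
    simp only [map_add, pderiv_C, map_sum, Derivation.leibniz, smul_eq_mul, map_mul, eval_X,
      pderiv_X, Pi.zero_apply, zero_mul, zero_add]
    rw [Finset.sum_eq_single c (by intro c' _ hc; simp [hc]) (by simp)]
    simp
  have hdet : ∀ u : B → ℂ, eval u (Matrix.of A).det =
      (Matrix.of fun b c => eval u (A b c)).det := by
    intro u
    rw [RingHom.map_det]
    rfl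
  -- The system reads `A(u) u = 0`, and `A(0)` is the Jacobian: where `det A(u)` is nonzero, the
  -- only solution is `u = 0`.
  refine ⟨(Matrix.of A).det, ?_, fun u hu hg => ?_⟩
  · rw [hdet]
    simpa only [hAJ] using hJ
  · rw [hdet] at hu
    refine Matrix.eq_zero_of_mulVec_eq_zero hu ?_
    ext b
    have := hg b
    rw [hA b, h0 b] at this
    simpa [Matrix.mulVec, dotProduct, mul_comm] using this

end Polynomials

/-! ### Isolated points of contact from second derivatives -/

section Isolation

variable {σ B : Type*} [Fintype σ]

/-- The pullback of a linear functional under a polynomial map. -/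
def pullback (Φ : σ → MvPolynomial B ℂ) (ψ : Module.Dual ℂ (σ → ℂ)) : MvPolynomial B ℂ :=
  bind₁ Φ (linearForm ψ)

theorem eval_pullback (Φ : σ → MvPolynomial B ℂ) (ψ : Module.Dual ℂ (σ → ℂ)) (u : B → ℂ) :
    eval u (pullback Φ ψ) = ψ fun j => eval u (Φ j) := by
  rw [pullback, eval_bind₁_eq, eval_linearForm]

theorem eval_pderiv_pullback (Φ : σ → MvPolynomial B ℂ) (ψ : Module.Dual ℂ (σ → ℂ)) (u : B → ℂ)
    (b : B) : eval u (pderiv b (pullback Φ ψ)) = ψ fun j => eval u (pderiv b (Φ j)) := by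
  rw [pullback, pderiv_bind₁, map_sum]
  simp only [map_mul, eval_bind₁_eq]
  exact sum_pderiv_linearForm ψ _ _

theorem pullback_add_smul (Φ : σ → MvPolynomial B ℂ) (φ ψ : Module.Dual ℂ (σ → ℂ)) (c : ℂ) :
    pullback Φ (φ + c • ψ) = pullback Φ φ + C c * pullback Φ ψ := by
  refine MvPolynomial.funext fun u => ?_
  simp [eval_pullback]

/-- The chart `Φ` being an inverse of `U / F` on the open subset `F ≠ 0` of `X`, a linear space `L`
that is tangent to `X` at `x` and lies in the kernels of functionals `ψ b` with a non-degenerate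
system of second derivatives at `x` has `x` as an isolated point of contact. -/
theorem contactLocus_subset_singleton_of_det_ne_zero [Fintype B] [DecidableEq B]
    {X : Set (PSpace σ)} (Φ : σ → MvPolynomial B ℂ)
    (hΦ : ∀ u, (fun j => eval u (Φ j)) ≠ 0)
    (hX : ∀ u, (Projectivization.mk ℂ _ (hΦ u) : PSpace σ) ∈ X)
    {F : Module.Dual ℂ (σ → ℂ)} {U : B → Module.Dual ℂ (σ → ℂ)}
    (hF : ∀ u, F (fun j => eval u (Φ j)) = 1)
    (hU : ∀ u b, U b (fun j => eval u (Φ j)) = u b)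
    (hsurj : ∀ q ∈ X, F q.coords ≠ 0 → ∃ u, q = Projectivization.mk ℂ _ (hΦ u))
    (x : Fin 1 → PSpace σ) (hx : x 0 = Projectivization.mk ℂ _ (hΦ 0))
    {L : Submodule ℂ (σ → ℂ)} (hL : tangentSpace X (x 0) ≤ L)
    (ψ : B → Module.Dual ℂ (σ → ℂ)) (hψ : ∀ b, ∀ v ∈ L, ψ b v = 0) (β : B → B)
    (hdet : (Matrix.of fun b c =>
      eval 0 (pderiv c (pderiv (β b) (pullback Φ (ψ b))))).det ≠ 0) :
    contactLocus X x L ⊆ {x 0} := by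
  have hcontact : ∀ u, tangentSpace X (Projectivization.mk ℂ _ (hΦ u) : PSpace σ) ≤ L →
      ∀ b, eval u (pderiv (β b) (pullback Φ (ψ b))) = 0 := fun u hu b => by
    rw [eval_pderiv_pullback]
    exact hψ b _ (hu (pderiv_mem_tangentSpace Φ hΦ hX u (β b)))
  obtain ⟨h, h0, hiso⟩ := exists_isolating_polynomial
    (fun b => pderiv (β b) (pullback Φ (ψ b))) (hcontact 0 (hx ▸ hL)) hdet
  have hcoord : ∀ u, F (PSpace.coords (Projectivization.mk ℂ _ (hΦ u) : PSpace σ)) ≠ 0 ∧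
      (fun b => U b (PSpace.coords (Projectivization.mk ℂ _ (hΦ u) : PSpace σ)) /
        F (PSpace.coords (Projectivization.mk ℂ _ (hΦ u) : PSpace σ))) = u := fun u => by
    obtain ⟨c, hc, hcu⟩ := PSpace.exists_coords_mk _ (hΦ u)
    rw [hcu]
    simp only [map_smul, hF, hU, smul_eq_mul, mul_one]
    exact ⟨hc, by ext b; field_simp⟩
  -- The isolating polynomial lives on the chart; the ratios `U b / F` recover the coordinates and
  -- turn its nonvanishing locus into an open set of projective space.
  refine contactLocus_subset_singleton x (isOpen_affineChart_ne_zero F U h) ?_ ?_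
  · rw [hx]
    refine ⟨(hcoord 0).1, ?_⟩
    rw [(hcoord 0).2]
    exact h0
  · rintro q ⟨hq1, hq2⟩ ⟨hqX, hqL⟩
    obtain ⟨u, rfl⟩ := hsurj q hqX hq1
    rw [(hcoord u).2] at hq2
    have : u = 0 := hiso u hq2 (hcontact u hqL)
    rw [hx, this]

end Isolation

/-! ### Deformation of the linear space -/

section Perturbation

variable {σ : Type*}

theorem isOpen_of_isOpen_affineZariski {ι : Type*} {O : Set (ι → ℂ)}
    (hO : IsOpen[affineZariski ι] O) : IsOpen O := by
  have hle : (inferInstance : TopologicalSpace (ι → ℂ)) ≤ affineZariski ι := by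
    refine le_generateFrom ?_
    rintro _ ⟨f, rfl⟩
    exact isOpen_ne_fun (MvPolynomial.continuous_eval f) continuous_const
  exact hle O hO

theorem exists_frame_span_eq [Finite σ] {k : ℕ} (L : Gr k σ) : ∃ w : Frame k σ, w.span = L := by
  let b := Module.finBasisOfFinrankEq ℂ L.1 L.2
  refine ⟨⟨fun i => (b i : σ → ℂ), ?_⟩, ?_⟩
  · exact b.linearIndependent.map' L.1.subtype (Submodule.ker_subtype _)
  · refine Subtype.ext ?_
    have h := congrArg (Submodule.map L.1.subtype) b.span_eq
    rw [Submodule.map_span, Submodule.map_top, Submodule.range_subtype, ← Set.range_comp] at h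
    exact h

/-- Small deformations of a linear space stay in a given Zariski open set. -/
theorem eventually_exists_eq_comap [Fintype σ] {k : ℕ} {G : Set (Gr k σ)} (hG : IsOpen G)
    {L : Gr k σ} (hL : L ∈ G) (A : (σ → ℂ) →L[ℂ] (σ → ℂ)) :
    ∀ᶠ t in 𝓝 (0 : ℂ), ∃ M ∈ G, ∀ v, v ∈ M.toSubmodule ↔ v + t • A v ∈ L.toSubmodule := by
  obtain ⟨w, rfl⟩ := exists_frame_span_eq L
  obtain ⟨O, hO, hOG⟩ := (@isOpen_induced_iff _ _ (affineZariski (Fin k × σ)) _ _).1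
    (isOpen_coinduced.1 hG)
  have hO' := isOpen_of_isOpen_affineZariski hO
  -- The deformed space is the preimage of `L` under `g t`, spanned by the frame `(g t)⁻¹ w`. This
  -- frame varies continuously near `t = 0`, and Zariski open sets of frames are open in the
  -- classical topology.
  let g : ℂ → (σ → ℂ) →L[ℂ] (σ → ℂ) := fun t => 1 + t • A
  have hg0 : g 0 = 1 := by
    ext v : 1
    simp [g]
  have hcont : ContinuousAt g 0 := by fun_prop
  have hinv : ContinuousAt (fun t : ℂ => Ring.inverse (g t)) 0 := by
    refine ContinuousAt.comp (g := Ring.inverse) ?_ hcont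
    rw [hg0]
    exact NormedRing.inverse_continuousAt (1 : ((σ → ℂ) →L[ℂ] (σ → ℂ))ˣ)
  have hunit : ∀ᶠ t in 𝓝 (0 : ℂ), IsUnit (g t) :=
    hcont.eventually (Units.isOpen.mem_nhds (by rw [hg0]; exact isUnit_one))
  have hframe : ContinuousAt (fun (t : ℂ) (v : Fin k × σ) =>
      Ring.inverse (g t) (w.1 v.1) v.2) 0 := by
    refine continuousAt_pi.2 fun v => ?_
    exact (continuous_apply v.2).continuousAt.comp (hinv.clm_apply continuousAt_const)
  have hmem : ∀ᶠ t in 𝓝 (0 : ℂ), (fun v : Fin k × σ =>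
      Ring.inverse (g t) (w.1 v.1) v.2) ∈ O := by
    refine hframe.eventually (hO'.mem_nhds ?_)
    have hw : w ∈ Frame.span ⁻¹' G := hL
    rw [← hOG] at hw
    beta_reduce
    rw [hg0, Ring.inverse_one]
    exact hw
  filter_upwards [hunit, hmem] with t ⟨e, he⟩ hmt
  rw [← he, Ring.inverse_unit] at hmt
  let ε : (σ → ℂ) ≃ₗ[ℂ] (σ → ℂ) := (ContinuousLinearEquiv.unitsEquiv ℂ (σ → ℂ) e).toLinearEquiv
  have hε : ∀ v, ε v = v + t • A v := fun v => by
    change (e : (σ → ℂ) →L[ℂ] (σ → ℂ)) v = _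
    rw [he]
    rfl
  let w' : Frame k σ := ⟨fun i => ε.symm (w.1 i), w.2.map' _ ε.symm.ker⟩
  refine ⟨w'.span, ?_, fun v => ?_⟩
  · have : w' ∈ Frame.span ⁻¹' G := by
      rw [← hOG]
      exact hmt
    exact this
  · have hspan : w'.span.toSubmodule = w.span.toSubmodule.map (ε.symm : (σ → ℂ) →ₗ[ℂ] (σ → ℂ)) := by
      change Submodule.span ℂ (Set.range fun i => ε.symm (w.1 i)) =
        (Submodule.span ℂ (Set.range w.1)).map _
      rw [Submodule.map_span, ← Set.range_comp]
      rfl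
    rw [hspan, Submodule.mem_map_equiv, LinearEquiv.symm_symm, hε]

/-- Part of a basis of the quotient by `L`, lifted to vectors `u`, with the matching coordinate
functionals as `φ`. -/
theorem exists_dual_family [Fintype σ] {B : Type*} [Fintype B] [DecidableEq B]
    (L : Submodule ℂ (σ → ℂ)) (h : Fintype.card B + Module.finrank ℂ L ≤ Fintype.card σ) :
    ∃ (φ : B → Module.Dual ℂ (σ → ℂ)) (u : B → σ → ℂ), (∀ b, ∀ v ∈ L, φ b v = 0) ∧
      ∀ b c, φ b (u c) = if b = c then 1 else 0 := by
  let bas := Module.finBasis ℂ ((σ → ℂ) ⧸ L)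
  have hcard : Fintype.card B ≤ Fintype.card (Fin (Module.finrank ℂ ((σ → ℂ) ⧸ L))) := by
    have := L.finrank_quotient_add_finrank
    rw [Module.finrank_fintype_fun_eq_card] at this
    rw [Fintype.card_fin]
    omega
  obtain ⟨ι⟩ := Function.Embedding.nonempty_of_card_le hcard
  choose u hu using fun b => L.mkQ_surjective (bas (ι b))
  refine ⟨fun b => bas.coord (ι b) ∘ₗ L.mkQ, u, fun b v hv => ?_, fun b c => ?_⟩
  · rw [LinearMap.comp_apply, Submodule.mkQ_apply, (Submodule.Quotient.mk_eq_zero L).2 hv, map_zero]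
  · rw [LinearMap.comp_apply, hu, Module.Basis.coord_apply, Module.Basis.repr_self,
      Finsupp.single_apply]
    simp [ι.injective.eq_iff, eq_comm]

/-- The determinant is the characteristic polynomial of `-J` at `t`, which has finitely many roots.
-/
theorem eventually_det_add_smul_one_ne_zero {B : Type*} [Fintype B] [DecidableEq B]
    (J : Matrix B B ℂ) : ∀ᶠ t in 𝓝[≠] (0 : ℂ), (J + t • (1 : Matrix B B ℂ)).det ≠ 0 := by
  have hroots : ((-J).charpoly.roots.toFinset : Set ℂ).Finite := Finset.finite_toSet _
  have hev : ∀ᶠ t in 𝓝[≠] (0 : ℂ), t ∉ ((-J).charpoly.roots.toFinset : Set ℂ) := by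
    have h1 : ((-J).charpoly.roots.toFinset \ {0} : Set ℂ)ᶜ ∈ 𝓝 (0 : ℂ) :=
      (hroots.subset Set.sdiff_subset).isClosed.isOpen_compl.mem_nhds (by simp)
    filter_upwards [mem_nhdsWithin_of_mem_nhds h1, self_mem_nhdsWithin] with t ht ht0 hmem
    exact ht ⟨hmem, ht0⟩
  filter_upwards [hev] with t ht hdet
  apply ht
  rw [Finset.mem_coe, Multiset.mem_toFinset, Polynomial.mem_roots (-J).charpoly_monic.ne_zero,
    Polynomial.IsRoot, Matrix.eval_charpoly, ← hdet]
  congr 1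
  rw [sub_neg_eq_add, add_comm, Matrix.smul_one_eq_diagonal, Matrix.scalar_apply]

/-- Near every linear space tangent to `X` at `x` of codimension at least the number of local
coordinates there is one for which `x` is an isolated point of contact, provided that all the
functionals `Q b`, equal to `u_b * u_(β b)` in local coordinates, vanish on the tangent space. -/
theorem exists_contactLocus_subset_singleton [Fintype σ] {B : Type*} [Fintype B] [DecidableEq B]
    {X : Set (PSpace σ)} (Φ : σ → MvPolynomial B ℂ)
    (hΦ : ∀ u, (fun j => eval u (Φ j)) ≠ 0)
    (hX : ∀ u, (Projectivization.mk ℂ _ (hΦ u) : PSpace σ) ∈ X)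
    {F : Module.Dual ℂ (σ → ℂ)} {U Q : B → Module.Dual ℂ (σ → ℂ)}
    (hF : ∀ u, F (fun j => eval u (Φ j)) = 1)
    (hU : ∀ u b, U b (fun j => eval u (Φ j)) = u b)
    (hsurj : ∀ q ∈ X, F q.coords ≠ 0 → ∃ u, q = Projectivization.mk ℂ _ (hΦ u))
    (x : Fin 1 → PSpace σ) (hx : x 0 = Projectivization.mk ℂ _ (hΦ 0))
    {β : B → B} (hβ : ∀ b, β b ≠ b)
    (hQ : ∀ u b, Q b (fun j => eval u (Φ j)) = u b * u (β b))
    (hQT : ∀ b, ∀ v ∈ tangentSpace X (x 0), Q b v = 0)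
    {k : ℕ} (hk : Fintype.card B + k ≤ Fintype.card σ) {G : Set (Gr k σ)} (hG : IsOpen G)
    {L : Gr k σ} (hLG : L ∈ G) (hL : tangentSpace X (x 0) ≤ L.toSubmodule) :
    ∃ M ∈ G, tangentSpace X (x 0) ≤ M.toSubmodule ∧
      contactLocus X x M.toSubmodule ⊆ {x 0} := by
  have hLk : Module.finrank ℂ L.toSubmodule = k := L.2
  obtain ⟨φ, u, hφ, hφu⟩ := exists_dual_family (B := B) L.toSubmodule (by rwa [hLk])
  -- Chosen so that `φ b ∘ A = Q b`: then `φ b + t • Q b` kills every `v` with `v + t • A v` in `L`.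
  -- As `A` vanishes on the tangent space, the deformation keeps that space inside.
  let A : (σ → ℂ) →L[ℂ] (σ → ℂ) :=
    LinearMap.toContinuousLinearMap (∑ b, (Q b).smulRight (u b))
  have hA : ∀ v, A v = ∑ b, Q b v • u b := fun v => by simp [A]
  have hφA : ∀ b v, φ b (A v) = Q b v := fun b v => by
    simp [hA, map_sum, hφu]
  have hJ := eventually_det_add_smul_one_ne_zero (Matrix.of fun b c =>
    eval 0 (pderiv c (pderiv (β b) (pullback Φ (φ b)))))
  obtain ⟨t, ⟨M, hMG, hM⟩, ht⟩ :=
    ((eventually_nhdsWithin_of_eventually_nhds (eventually_exists_eq_comap hG hLG A)).and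
      hJ).exists
  have hTM : tangentSpace X (x 0) ≤ M.toSubmodule := fun v hv => by
    have hAv : A v = 0 := by simp [hA, hQT _ v hv]
    rw [hM, hAv, smul_zero, add_zero]
    exact hL hv
  refine ⟨M, hMG, hTM, contactLocus_subset_singleton_of_det_ne_zero Φ hΦ hX hF hU hsurj x hx hTM
    (fun b => φ b + t • Q b) (fun b v hv => ?_) β ?_⟩
  · have := hφ b _ ((hM v).1 hv)
    rwa [map_add, map_smul, hφA] at this
  · convert ht using 2
    ext b c
    have hQX : pullback Φ (Q b) = MvPolynomial.X b * MvPolynomial.X (β b) :=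
      MvPolynomial.funext fun w => by simp [eval_pullback, hQ]
    have hQ1 : pderiv (β b) (pullback Φ (Q b)) = MvPolynomial.X b := by
      rw [hQX, Derivation.leibniz, pderiv_X_self, pderiv_X_of_ne (hβ b).symm]
      simp
    simp only [pullback_add_smul, map_add, pderiv_C_mul, hQ1, pderiv_X, Pi.single_apply,
      Matrix.of_apply, Matrix.add_apply, Matrix.smul_apply, Matrix.one_apply]
    by_cases hbc : b = c <;> simp [hbc]

end Perturbation

/-! ### Affine charts and quadrics of the Segre-Veronese variety -/

section Chart

variable {r : ℕ} {n d : Fin r → ℕ}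

theorem monomialVector_smul (c : Fin r → ℂ) (z : ∀ i, Fin (n i + 1) → ℂ) :
    monomialVector n d (fun i => c i • z i) = (∏ i, c i ^ d i) • monomialVector n d z := by
  ext J
  simp only [monomialVector, Pi.smul_apply, smul_eq_mul, ← Finset.prod_mul_distrib]
  refine Finset.prod_congr rfl fun i _ => ?_
  rw [Multiset.prod_map_mul, Multiset.map_const', Multiset.prod_replicate, Sym.card_coe]

/-- Every product of linear forms of the right multidegree is a linear functional of the monomial
vector. -/
theorem exists_dual_monomialVector (a : ∀ i, Fin (d i) → Fin (n i + 1) → ℂ) :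
    ∃ E : Module.Dual ℂ (MonomialIndex n d → ℂ), ∀ z : ∀ i, Fin (n i + 1) → ℂ,
      E (monomialVector n d z) = ∏ i, ∏ t, ∑ k, a i t k * z i k := by
  -- Expanding the product amounts to choosing a variable `κ i t` in each linear form; `J κ` is the
  -- resulting monomial.
  let J : (∀ i, Fin (d i) → Fin (n i + 1)) → MonomialIndex n d := fun κ i =>
    ⟨Finset.univ.val.map (κ i), by simp⟩
  refine ⟨∑ κ : ∀ i, Fin (d i) → Fin (n i + 1), (∏ i, ∏ t, a i t (κ i t)) •
    LinearMap.proj (J κ), fun z => ?_⟩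
  simp only [Finset.prod_univ_sum, Fintype.piFinset_univ, LinearMap.sum_apply, LinearMap.smul_apply,
    LinearMap.proj_apply, smul_eq_mul]
  refine Finset.sum_congr rfl fun κ _ => ?_
  rw [monomialVector, ← Finset.prod_mul_distrib]
  refine Finset.prod_congr rfl fun i _ => ?_
  rw [Finset.prod_mul_distrib]
  congr 1
  change ((Finset.univ.val.map (κ i)).map (z i)).prod = _
  rw [Multiset.map_map]
  rfl

theorem prod_ite_val_eq_zero {α : Type*} {D : ℕ} (hD : 0 < D) (f : α → ℂ) (a b : α) :
    ∏ t : Fin D, f (if (t : ℕ) = 0 then a else b) = f a * f b ^ (D - 1) := by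
  obtain ⟨E, rfl⟩ : ∃ E, D = E + 1 := ⟨D - 1, by omega⟩
  rw [Fin.prod_univ_succ]
  simp

/-- The coordinate `κ i` with respect to `e i`, times a power of the coordinate `0`, in each factor. -/
def coordinateProduct (d : Fin r → ℕ)
    (e : ∀ i, (Fin (n i + 1) → ℂ) ≃ₗ[ℂ] (Fin (n i + 1) → ℂ))
    (κ : ∀ i, Fin (n i + 1)) (z : ∀ i, Fin (n i + 1) → ℂ) : ℂ :=
  ∏ i, e i (z i) (κ i) * e i (z i) 0 ^ (d i - 1)

theorem sum_apply_single_mul {ι : Type*} [Fintype ι] [DecidableEq ι] (e : (ι → ℂ) ≃ₗ[ℂ] (ι → ℂ))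
    (v : ι → ℂ) (l : ι) : ∑ k, e (Pi.single k 1) l * v k = e v l :=
  (dual_apply_eq_sum (LinearMap.proj l ∘ₗ e.toLinearMap) v).symm

theorem exists_dual_coordinateProduct (hd : ∀ i, 0 < d i)
    (e : ∀ i, (Fin (n i + 1) → ℂ) ≃ₗ[ℂ] (Fin (n i + 1) → ℂ)) (κ : ∀ i, Fin (n i + 1)) :
    ∃ E : Module.Dual ℂ (MonomialIndex n d → ℂ), ∀ z,
      E (monomialVector n d z) = coordinateProduct d e κ z := by
  let a : ∀ i, Fin (d i) → Fin (n i + 1) → ℂ := fun i t k =>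
    e i (Pi.single k 1) (if (t : ℕ) = 0 then κ i else 0)
  obtain ⟨E, hE⟩ := exists_dual_monomialVector a
  refine ⟨E, fun z => (hE z).trans (Finset.prod_congr rfl fun i _ => ?_)⟩
  rw [← prod_ite_val_eq_zero (hd i) (e i (z i)) (κ i) 0]
  exact Finset.prod_congr rfl fun t _ => sum_apply_single_mul (e i) (z i) _

/-- The point of `ℂ^(n_i + 1)` with affine coordinates `u i` in the frame given by `e i`. -/
def affinePoint (e : ∀ i, (Fin (n i + 1) → ℂ) ≃ₗ[ℂ] (Fin (n i + 1) → ℂ))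
    (u : (Σ i, Fin (n i)) → ℂ) (i : Fin r) : Fin (n i + 1) → ℂ :=
  (e i).symm (Fin.cons 1 fun k => u ⟨i, k⟩)

/-- The coordinates of `affinePoint` as polynomials. -/
def affinePointPoly (e : ∀ i, (Fin (n i + 1) → ℂ) ≃ₗ[ℂ] (Fin (n i + 1) → ℂ)) (i : Fin r)
    (j : Fin (n i + 1)) : MvPolynomial (Σ i, Fin (n i)) ℂ :=
  ∑ k, C ((e i).symm (Pi.single k 1) j) *
    (Fin.cons 1 (fun l => X ⟨i, l⟩) : Fin (n i + 1) → MvPolynomial (Σ i, Fin (n i)) ℂ) k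

theorem eval_affinePointPoly (e : ∀ i, (Fin (n i + 1) → ℂ) ≃ₗ[ℂ] (Fin (n i + 1) → ℂ))
    (u : (Σ i, Fin (n i)) → ℂ) (i : Fin r) (j : Fin (n i + 1)) :
    eval u (affinePointPoly e i j) = affinePoint e u i j := by
  have h := dual_apply_eq_sum
    (LinearMap.proj j ∘ₗ ((e i).symm : (Fin (n i + 1) → ℂ) →ₗ[ℂ] (Fin (n i + 1) → ℂ)))
    (Fin.cons 1 fun k => u ⟨i, k⟩)
  refine Eq.trans ?_ h.symm
  rw [affinePointPoly, map_sum]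
  refine Finset.sum_congr rfl fun k _ => ?_
  refine Fin.cases ?_ (fun l => ?_) k <;> simp

/-- The affine chart of the Segre-Veronese variety given by the frames `e i`. -/
def chart (d : Fin r → ℕ) (e : ∀ i, (Fin (n i + 1) → ℂ) ≃ₗ[ℂ] (Fin (n i + 1) → ℂ))
    (J : MonomialIndex n d) : MvPolynomial (Σ i, Fin (n i)) ℂ :=
  ∏ i, ((J i : Multiset (Fin (n i + 1))).map (affinePointPoly e i)).prod

theorem eval_chart (e : ∀ i, (Fin (n i + 1) → ℂ) ≃ₗ[ℂ] (Fin (n i + 1) → ℂ))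
    (u : (Σ i, Fin (n i)) → ℂ) :
    (fun J => eval u (chart d e J)) = monomialVector n d (affinePoint e u) := by
  ext J
  simp only [chart, monomialVector, map_prod, map_multiset_prod, Multiset.map_map,
    Function.comp_def, eval_affinePointPoly]

theorem affinePoint_ne_zero (e : ∀ i, (Fin (n i + 1) → ℂ) ≃ₗ[ℂ] (Fin (n i + 1) → ℂ))
    (u : (Σ i, Fin (n i)) → ℂ) (i : Fin r) : affinePoint e u i ≠ 0 := by
  rw [affinePoint, Ne, LinearEquiv.map_eq_zero_iff]
  intro h
  simpa using congrFun h 0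

theorem eval_chart_ne_zero (e : ∀ i, (Fin (n i + 1) → ℂ) ≃ₗ[ℂ] (Fin (n i + 1) → ℂ))
    (u : (Σ i, Fin (n i)) → ℂ) : (fun J => eval u (chart d e J)) ≠ 0 := by
  rw [eval_chart]
  exact monomialVector_ne_zero n d _ (affinePoint_ne_zero e u)

theorem mk_eval_chart_mem (e : ∀ i, (Fin (n i + 1) → ℂ) ≃ₗ[ℂ] (Fin (n i + 1) → ℂ))
    (u : (Σ i, Fin (n i)) → ℂ) :
    (Projectivization.mk ℂ _ (eval_chart_ne_zero (d := d) e u) : PSpace (MonomialIndex n d)) ∈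
      segreVeronese n d := by
  refine ⟨affinePoint e u, affinePoint_ne_zero e u, ?_⟩
  congr 1
  exact eval_chart e u

theorem coordinateProduct_affinePoint
    (e : ∀ i, (Fin (n i + 1) → ℂ) ≃ₗ[ℂ] (Fin (n i + 1) → ℂ)) (κ : ∀ i, Fin (n i + 1))
    (u : (Σ i, Fin (n i)) → ℂ) : coordinateProduct d e κ (affinePoint e u) =
      ∏ i, (Fin.cons 1 (fun k => u ⟨i, k⟩) : Fin (n i + 1) → ℂ) (κ i) := by
  simp [coordinateProduct, affinePoint]

/-- A point of the Segre-Veronese variety off the hyperplane at infinity lies in the chart. -/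
theorem exists_eq_mk_eval_chart
    (e : ∀ i, (Fin (n i + 1) → ℂ) ≃ₗ[ℂ] (Fin (n i + 1) → ℂ))
    {F : Module.Dual ℂ (MonomialIndex n d → ℂ)}
    (hF : ∀ z, F (monomialVector n d z) = coordinateProduct d e (fun _ => 0) z)
    (q : PSpace (MonomialIndex n d)) (hq : q ∈ segreVeronese n d) (hFq : F q.coords ≠ 0) :
    ∃ u, q = Projectivization.mk ℂ _ (eval_chart_ne_zero (d := d) e u) := by
  obtain ⟨z, hz, rfl⟩ := hq
  obtain ⟨c, hc, hcz⟩ := PSpace.exists_coords_mk _ (monomialVector_ne_zero n d z hz)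
  rw [hcz, map_smul, hF, smul_eq_mul, coordinateProduct] at hFq
  have h0 : ∀ i, e i (z i) 0 ≠ 0 := fun i h => by
    refine hFq (mul_eq_zero_of_right _ (Finset.prod_eq_zero (Finset.mem_univ i) ?_))
    rw [h, zero_mul]
  refine ⟨fun b => e b.1 (z b.1) b.2.succ / e b.1 (z b.1) 0, ?_⟩
  -- Normalizing the zeroth coordinate of each `z i` to 1 divides the monomial vector by this
  -- scalar.
  refine (Projectivization.mk_eq_mk_iff' ℂ _ _ _ _).2 ⟨∏ i, (e i (z i) 0) ^ d i, ?_⟩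
  rw [eval_chart, ← monomialVector_smul]
  congr 1
  ext1 i
  rw [affinePoint, ← map_smul, LinearEquiv.symm_apply_eq]
  ext k
  refine Fin.cases ?_ (fun l => ?_) k
  · simp
  · have := h0 i
    simp only [Pi.smul_apply, Fin.cons_succ, smul_eq_mul]
    field_simp

/-- The index whose only nonzero entry is `b.2.succ`, in position `b.1`. -/
def singleIndex (b : Σ i, Fin (n i)) : ∀ i, Fin (n i + 1) :=
  Function.update (fun _ => 0) b.1 b.2.succ

/-- The index with the two nonzero entries given by `b` and `c`. -/
def pairIndex (b c : Σ i, Fin (n i)) : ∀ i, Fin (n i + 1) :=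
  Function.update (singleIndex c) b.1 b.2.succ

/-- In each factor the two sides multiply the same two coordinates, possibly swapped. If `b` and `c`
lay in the same factor, `pairIndex` would overwrite the entry of `c`. -/
theorem coordinateProduct_pairIndex_mul
    (e : ∀ i, (Fin (n i + 1) → ℂ) ≃ₗ[ℂ] (Fin (n i + 1) → ℂ)) {b c : Σ i, Fin (n i)}
    (h : b.1 ≠ c.1) (z : ∀ i, Fin (n i + 1) → ℂ) :
    coordinateProduct d e (pairIndex b c) z * coordinateProduct d e (fun _ => 0) z =
      coordinateProduct d e (singleIndex b) z * coordinateProduct d e (singleIndex c) z := by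
  simp only [coordinateProduct, ← Finset.prod_mul_distrib]
  refine Finset.prod_congr rfl fun i _ => ?_
  by_cases hb : i = b.1
  · subst hb
    simp [pairIndex, singleIndex, Function.update_of_ne h]
  · simp [pairIndex, singleIndex, Function.update_of_ne hb]
    ring

theorem coordinateProduct_zero_affinePoint
    (e : ∀ i, (Fin (n i + 1) → ℂ) ≃ₗ[ℂ] (Fin (n i + 1) → ℂ)) (u : (Σ i, Fin (n i)) → ℂ) :
    coordinateProduct d e (fun _ => 0) (affinePoint e u) = 1 := by
  simp [coordinateProduct_affinePoint]

theorem coordinateProduct_singleIndex_affinePoint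
    (e : ∀ i, (Fin (n i + 1) → ℂ) ≃ₗ[ℂ] (Fin (n i + 1) → ℂ)) (u : (Σ i, Fin (n i)) → ℂ)
    (b : Σ i, Fin (n i)) : coordinateProduct d e (singleIndex b) (affinePoint e u) = u b := by
  rw [coordinateProduct_affinePoint, Finset.prod_eq_single b.1
    (fun i _ hi => by simp [singleIndex, Function.update_of_ne hi]) (by simp)]
  simp [singleIndex]

/-- With `P` the product over all factors but the first and `S` the sum of all `n i` but the last,
the full product is at least `2 * P`. One copy of `P` bounds `s + S`, the other bounds the last `n
i` plus one. -/
theorem card_add_le_card_monomialIndex {m : ℕ} (hm : 1 ≤ m) {n d : Fin (m + 1) → ℕ}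
    (hn : ∀ i, 0 < n i) (hd : ∀ i, 0 < d i) {s : ℕ}
    (hs : (s : ℤ) ≤ (∏ i : Fin m, ((n i.succ + d i.succ).choose (n i.succ) : ℤ))
      - (n (Fin.last m) : ℤ) * ∑ i : Fin m, (n i.castSucc : ℤ)) :
    Fintype.card (Σ i, Fin (n i)) + (s + 1) ≤ Fintype.card (MonomialIndex n d) := by
  have hcard : Fintype.card (MonomialIndex n d) =
      ∏ i, (n i + d i).choose (n i) := by
    rw [Fintype.card_pi]
    refine Finset.prod_congr rfl fun i _ => ?_
    rw [Sym.card_sym_eq_choose, Fintype.card_fin, Nat.add_right_comm, Nat.add_sub_cancel,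
      Nat.choose_symm_add]
  have hge : ∀ i, n i + 1 ≤ (n i + d i).choose (n i) := fun i => by
    calc n i + 1 = (n i + 1).choose (n i) := by simp
      _ ≤ _ := Nat.choose_le_choose _ (Nat.add_le_add_left (hd i) _)
  rw [hcard, Fin.prod_univ_succ]
  simp only [Fintype.card_sigma, Fintype.card_fin]
  rw [Fin.sum_univ_castSucc]
  set P := ∏ i : Fin m, (n i.succ + d i.succ).choose (n i.succ) with hP
  set S := ∑ i : Fin m, n i.castSucc with hS
  have hPlast : n (Fin.last m) + 1 ≤ P := by
    obtain ⟨l, rfl⟩ : ∃ l, m = l + 1 := ⟨m - 1, by omega⟩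
    refine (hge (Fin.last (l + 1))).trans ?_
    rw [← Fin.succ_last]
    exact Finset.single_le_prod' (f := fun i : Fin (l + 1) =>
      (n i.succ + d i.succ).choose (n i.succ)) (fun i _ => (Nat.le_add_left 1 _).trans (hge i.succ))
      (Finset.mem_univ (Fin.last l))
  have hs' : s + n (Fin.last m) * S ≤ P := by
    have : ((s + n (Fin.last m) * S : ℕ) : ℤ) ≤ (P : ℕ) := by
      rw [hP, hS]
      push_cast
      linarith
    exact_mod_cast this
  have h0 : 2 * P ≤ (n 0 + d 0).choose (n 0) * P :=
    Nat.mul_le_mul_right _ (le_trans (by have := hn 0; omega) (hge 0))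
  have h1 : S ≤ n (Fin.last m) * S := Nat.le_mul_of_pos_left _ (hn _)
  omega

/-- Near every linear space of large codimension tangent to the Segre-Veronese variety at `x` there
is one for which `x` is an isolated point of contact. -/
theorem segreVeronese_exists_contactLocus_subset_singleton [Nontrivial (Fin r)]
    (hn : ∀ i, 0 < n i) (hd : ∀ i, 0 < d i) (x : Fin 1 → PSpace (MonomialIndex n d))
    (hx : x 0 ∈ segreVeronese n d) {k : ℕ}
    (hk : Fintype.card (Σ i, Fin (n i)) + k ≤ Fintype.card (MonomialIndex n d))
    {G : Set (Gr k (MonomialIndex n d))} (hG : IsOpen G) {L : Gr k (MonomialIndex n d)}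
    (hLG : L ∈ G) (hL : tangentSpace (segreVeronese n d) (x 0) ≤ L.toSubmodule) :
    ∃ M ∈ G, tangentSpace (segreVeronese n d) (x 0) ≤ M.toSubmodule ∧
      contactLocus (segreVeronese n d) x M.toSubmodule ⊆ {x 0} := by
  obtain ⟨z, hz, hxz⟩ := hx
  have hframe : ∀ i, ∃ e : (Fin (n i + 1) → ℂ) ≃ₗ[ℂ] (Fin (n i + 1) → ℂ),
      e (z i) = Pi.single 0 1 := fun i => by
    obtain ⟨A, hA⟩ := SeparatingDual.exists_continuousLinearEquiv_apply_eq (R := ℂ) (hz i)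
      (y := Pi.single 0 1) (by simp)
    exact ⟨A.toLinearEquiv, hA⟩
  choose e he using hframe
  have hzero : affinePoint e 0 = z := by
    ext1 i
    rw [affinePoint, LinearEquiv.symm_apply_eq, he]
    ext k
    refine Fin.cases ?_ (fun l => ?_) k <;> simp
  have hx0 : x 0 = Projectivization.mk ℂ _ (eval_chart_ne_zero (d := d) e 0) := by
    rw [hxz]
    congr 1
    rw [eval_chart, hzero]
  choose E hE using exists_dual_coordinateProduct hd e
  choose ρ hρ using fun i : Fin r => exists_ne i
  -- Any coordinate of a different factor serves, and `β` need not be injective: equation `b` is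
  -- perturbed by `u_b` alone.
  let β : (Σ i, Fin (n i)) → Σ i, Fin (n i) := fun b => ⟨ρ b.1, ⟨0, hn _⟩⟩
  have hβ : ∀ b, b.1 ≠ (β b).1 := fun b => (hρ b.1).symm
  have hquadric : ∀ b z, E (pairIndex b (β b)) (monomialVector n d z) *
      E (fun _ => 0) (monomialVector n d z) = E (singleIndex b) (monomialVector n d z) *
      E (singleIndex (β b)) (monomialVector n d z) := fun b z => by
    simp only [hE]
    exact coordinateProduct_pairIndex_mul e (hβ b) z
  have hF : ∀ u, E (fun _ => 0) (fun J => eval u (chart d e J)) = 1 := fun u => by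
    rw [eval_chart, hE, coordinateProduct_zero_affinePoint]
  have hU : ∀ u b, E (singleIndex b) (fun J => eval u (chart d e J)) = u b := fun u b => by
    rw [eval_chart, hE, coordinateProduct_singleIndex_affinePoint]
  have hQ : ∀ u b, E (pairIndex b (β b)) (fun J => eval u (chart d e J)) = u b * u (β b) :=
    fun u b => by
      have h := hquadric b (affinePoint e u)
      rwa [← eval_chart, hF, hU, hU, mul_one] at h
  refine exists_contactLocus_subset_singleton (chart d e) (eval_chart_ne_zero e)
    (mk_eval_chart_mem e) (Q := fun b => E (pairIndex b (β b))) hF hU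
    (exists_eq_mk_eval_chart e (hE _)) x hx0 (β := β)
    (fun b h => hβ b (congrArg Sigma.fst h).symm) hQ (fun b v hv => ?_) hk hG hLG hL
  obtain ⟨c, hc, hcx⟩ := PSpace.exists_coords_mk _ (eval_chart_ne_zero (d := d) e 0)
  rw [← hx0] at hcx
  -- The quadric relation puts `Q b` in the role of `F`; at the origin of the chart `Q b` and both
  -- coordinates vanish, while the zeroth form does not.
  refine eq_zero_of_mem_tangentSpace (G := E fun _ => 0) (U := E (singleIndex b))
    (W := E (singleIndex (β b))) ?_ ?_ ?_ ?_ ?_ hv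
  · rintro q ⟨y, hy, rfl⟩
    obtain ⟨a, -, ha⟩ := PSpace.exists_coords_mk _ (monomialVector_ne_zero n d y hy)
    simp only [ha, map_smul, smul_eq_mul]
    linear_combination a ^ 2 * hquadric b y
  · rw [hcx, map_smul, hQ, Pi.zero_apply, zero_mul, smul_zero]
  · rw [hcx, map_smul, hU, Pi.zero_apply, smul_zero]
  · rw [hcx, map_smul, hU, Pi.zero_apply, smul_zero]
  · rwa [hcx, map_smul, hF, smul_eq_mul, mul_one]

end Chart

end SegreVeronese

end

theorem mainTheorem3 (m : ℕ) (hm : 1 ≤ m) (n d : Fin (m + 1) → ℕ)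
    (hn : ∀ i, 0 < n i) (hd : ∀ i, 0 < d i) (hlast : d (Fin.last m) = 1)
    (hgt : ∑ i : Fin m, n i.castSucc < n (Fin.last m)) (s : ℕ)
    (hs : (s : ℤ) ≤ (∏ i : Fin m, ((n i.succ + d i.succ).choose (n i.succ) : ℤ))
      - (n (Fin.last m) : ℤ) * ∑ i : Fin m, (n i.castSucc : ℤ)) :
    ¬ SegreVeronese.IsTangentiallyWeaklyDefective 1 s (SegreVeronese.segreVeronese n d) := by
  open SegreVeronese in
  -- One point `x` of `U` on the variety is enough, since isolated contact can be achieved at every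
  -- point.
  rintro ⟨U, -, ⟨x, hxU, hxX⟩, h⟩
  obtain ⟨G, hG, ⟨L, hLG, hL⟩, hpos⟩ := h x hxU hxX
  have hspan : tangentSpan (segreVeronese n d) x = tangentSpace (segreVeronese n d) (x 0) :=
    iSup_unique _
  have : Nontrivial (Fin (m + 1)) := Fin.nontrivial_iff_two_le.2 (by omega)
  rw [hspan] at hL hpos
  obtain ⟨M, hMG, hM, hsub⟩ := segreVeronese_exists_contactLocus_subset_singleton hn hd x (hxX 0)
    (card_add_le_card_monomialIndex hm hn hd hs) hG hLG hL
  exact (hpos M hMG hM).not_ge (topologicalKrullDim_nonpos_of_subset_singleton hsub)
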